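/- Let $K$ be a non-discrete locally compact field, that is, a (commutative) field with a non-discrete locally compact Hausdorff topology for which the field operations are continuous. (Such a $K$ is automatically infinite.) Let $\mathcal W$ be any uniformity inducing the topology of $K$ such that some $W\in\mathcal W$ has all sections $W(x)=\{y\in K:(x,y)\in W\}$ relatively compact; for example, the uniformity of the additive group of $K$. Then $K$ is not approximable by finite associative rings, even if these are allowed to be non-commutative and without unit. Here, for a compact set $C\subseteq K$ and $W\in\mathcal W$, a $(C,W)$-approximation of $K$ by a finite ring $\langle F,\oplus,\odot\rangle$ is a map $j\colon F\to K$ such that 1. for every $c\in C$ there is $a\in F$ with $(c,j(a))\in W$; 2. for all $a,b\in F$ with $j(a),j(b)\in C$: if $j(a)+j(b)\in C$, then $(j(a)+j(b),\,j(a\oplus b))\in W$; and if $j(a)\cdot j(b)\in C$, then $(j(a)\cdot j(b),\,j(a\odot b))\in W$. $K$ is approximable by finite associative rings if for every compact $C\subseteq K$ and every $W\in\mathcal W$ all of whose sections $W(x)$ are relatively compact there exist a finite associative ring $F$ and a $(C,W)$-approximation $j\colon F\to K$. In other words, there are a compact $C\subseteq K$ and such a $W\in\mathcal W$ for which no finite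 associative ring admits a $(C,W)$-approximation of $K$. -/

import Mathlib

open Set Filter Topology Uniformity

/-!  Finite approximation of topological algebras of signature `(+, ×)`. -/

/-- `W` has relatively compact sections: for every `x`, the closure of
`W(x) = {y | (x, y) ∈ W}` is compact. -/
def HasCompactSections {A : Type*} [TopologicalSpace A] (W : Set (A × A)) : Prop :=
  ∀ x : A, IsCompact (closure {y : A | (x, y) ∈ W})

/-- `A` is uniformly locally compact: some entourage has relatively compact sections. -/
def IsUniformlyLocallyCompact (A : Type*) [UniformSpace A] : Prop :=
  ∃ W ∈ 𝓤 A, HasCompactSections W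

/-- For the additive uniformity of a topological abelian group, uniform local compactness is
just local compactness. -/
theorem isUniformlyLocallyCompact_of_isUniformAddGroup (A : Type*) [AddCommGroup A]
    [UniformSpace A] [IsUniformAddGroup A] [LocallyCompactSpace A] :
    IsUniformlyLocallyCompact A := by
  obtain ⟨S, hS, hS0⟩ := exists_compact_mem_nhds (0 : A)
  refine ⟨(fun p : A × A => p.2 - p.1) ⁻¹' S, ?_, fun x => ?_⟩
  · rw [uniformity_eq_comap_nhds_zero A]
    exact preimage_mem_comap hS0
  · have h : {y : A | (x, y) ∈ (fun p : A × A => p.2 - p.1) ⁻¹' S} = (fun y => y + x) '' S := by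
      ext y
      simp only [mem_preimage, mem_ofPred_eq, mem_image]
      exact ⟨fun hy => ⟨y - x, hy, by simp⟩, by rintro ⟨z, hz, rfl⟩; simpa using hz⟩
    rw [h]
    exact (hS.image (by fun_prop)).closure

/-- `M` is a `(C, W)`-grid: every point of `C` is `W`-close to some point of `M`. -/
def IsGrid {A : Type*} (C : Set A) (W : Set (A × A)) (M : Set A) : Prop :=
  ∀ c ∈ C, ∃ m ∈ M, (c, m) ∈ W

/-- `j` is a `(C, W)`-homomorphism with respect to the binary operations `opF` on `F` and
`opA` on `A`. -/
def IsApproxHomFor {A F : Type*} (C : Set A) (W : Set (A × A)) (opA : A → A → A)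
    (opF : F → F → F) (j : F → A) : Prop :=
  ∀ a b : F, j a ∈ C → j b ∈ C → opA (j a) (j b) ∈ C → (opA (j a) (j b), j (opF a b)) ∈ W

/-- `j : F → A` is a `(C, W)`-homomorphism for the signature `(+, ×)`. -/
def IsApproxHom {A F : Type*} [Add A] [Mul A] [Add F] [Mul F]
    (C : Set A) (W : Set (A × A)) (j : F → A) : Prop :=
  IsApproxHomFor C W (· + ·) (· + ·) j ∧ IsApproxHomFor C W (· * ·) (· * ·) j

/-- The pair `(F, j)` is a `(C, W)`-approximation of `A`, in the signature `(+, ×)`. -/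
def IsCWApproximation {A F : Type*} [Add A] [Mul A] [Add F] [Mul F]
    (C : Set A) (W : Set (A × A)) (j : F → A) : Prop :=
  IsApproxHom C W j ∧ IsGrid C W (range j)

/-- `A` is approximable by finite associative rings: for every compact set `C` and every entourage
`W` with relatively compact sections there is a `(C, W)`-approximation `(F, j)` of `A` with `F` a
finite associative ring (not necessarily commutative and not necessarily with a unit). -/
def ApproximableByFiniteRings (A : Type*) [UniformSpace A] [Add A] [Mul A] : Prop :=
  ∀ C : Set A, IsCompact C → ∀ W ∈ 𝓤 A, HasCompactSections W →
    ∃ (F : Type) (_ : NonUnitalRing F) (_ : Finite F) (j : F → A), IsCWApproximation C W j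

/-! The proof splits on whether the additive group generated by `1` has compact closure. If it has,
K is a union of compact subgroups, so it has a compact open subgroup, whose multipliers form a
compact open subring O. Some nonzero a in O has a⁻¹ outside O; then N = aO and T = 1 + aO are
disjoint and multiplicatively closed. A fine approximation turns them into disjoint subsemigroups of
a finite semigroup, together with elements near a⁻¹ and a whose product lies in T. In a minimal
corner at an idempotent of T, one-sided invertibility then forces an idempotent of N to equal that
of T (`exists_idempotent_corner_mul_notMem`). Only multiplication in F is used. Otherwise no compact
set contains all positive multiples of a nonzero element. As in Gleason's arguments, take x in F
whose multiples stay longest in a compact neighbourhood D of 0, escaping at time N. In the limit x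
tends to 0 and Nx to some w ≠ 0. For k ≤ N, k(x²) = (kx)x tends to 0, so by maximality x² never
escapes. All multiples of w² then lie in D, so w² = 0, which is absurd. -/

open scoped Pointwise

universe u

/-! ### Compact open subgroups and subrings -/

/-- A finite family of elements of compact subgroups lies in one compact subgroup. -/
theorem exists_compact_addSubgroup_of_finset {A : Type*} [AddCommGroup A] [TopologicalSpace A]
    [ContinuousAdd A] (h : ∀ x : A, ∃ G : AddSubgroup A, IsCompact (G : Set A) ∧ x ∈ G)
    (t : Finset A) : ∃ G : AddSubgroup A, IsCompact (G : Set A) ∧ ∀ x ∈ t, x ∈ G := by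
  classical
  induction t using Finset.induction_on with
  | empty => exact ⟨⊥, by simp, by simp⟩
  | insert x t _ ih =>
    obtain ⟨G, hG, hGt⟩ := ih
    obtain ⟨P, hP, hx⟩ := h x
    refine ⟨P ⊔ G, ?_, fun y hy => ?_⟩
    · rw [AddSubgroup.add_normal P G]
      exact hP.add hG
    · rcases Finset.mem_insert.1 hy with rfl | hy
      · exact AddSubgroup.mem_sup_left hx
      · exact AddSubgroup.mem_sup_right (hGt y hy)

/-- A locally compact abelian group that is a union of compact subgroups has a compact open
subgroup. -/
theorem exists_compact_open_addSubgroup {A : Type*} [AddCommGroup A] [TopologicalSpace A]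
    [IsTopologicalAddGroup A] [LocallyCompactSpace A] [T2Space A]
    (h : ∀ x : A, ∃ G : AddSubgroup A, IsCompact (G : Set A) ∧ x ∈ G) :
    ∃ L : AddSubgroup A, IsCompact (L : Set A) ∧ IsOpen (L : Set A) := by
  obtain ⟨V₀, hV₀, hV₀0⟩ := exists_compact_mem_nhds (0 : A)
  obtain ⟨V, hV, hV0, hVneg⟩ : ∃ V : Set A, IsCompact V ∧ V ∈ 𝓝 0 ∧ ∀ x ∈ V, -x ∈ V := by
    refine ⟨V₀ ∩ -V₀, hV₀.inter hV₀.neg, inter_mem hV₀0 (neg_mem_nhds_zero A hV₀0), ?_⟩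
    rintro x ⟨h1, h2⟩
    exact ⟨h2, by simpa using h1⟩
  -- Finitely many translates of V cover V + V. Their centres lie in a compact subgroup G, so V + V
  -- ⊆ G + V and G + V is a subgroup.
  obtain ⟨t, -, ht⟩ := (hV.add hV).elim_nhds_subcover (fun x => (fun y => y - x) ⁻¹' V) fun x _ =>
    (continuous_id.sub continuous_const).continuousAt.preimage_mem_nhds (by simpa using hV0)
  obtain ⟨G, hG, hGt⟩ := exists_compact_addSubgroup_of_finset h t
  have hVV : ∀ x ∈ V, ∀ y ∈ V, ∃ g ∈ G, ∃ z ∈ V, g + z = x + y := by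
    intro x hx y hy
    obtain ⟨c, hc, hz⟩ := mem_iUnion₂.1 (ht (add_mem_add hx hy))
    exact ⟨c, hGt c hc, _, hz, add_sub_cancel c (x + y)⟩
  let L : AddSubgroup A :=
    { carrier := (G : Set A) + V
      zero_mem' := ⟨0, G.zero_mem, 0, mem_of_mem_nhds hV0, by simp⟩
      add_mem' := by
        rintro _ _ ⟨g, hg, v, hv, rfl⟩ ⟨g', hg', v', hv', rfl⟩
        obtain ⟨k, hk, z, hz, e⟩ := hVV v hv v' hv'
        refine ⟨g + g' + k, G.add_mem (G.add_mem hg hg') hk, z, hz, ?_⟩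
        change g + g' + k + z = g + v + (g' + v')
        rw [add_assoc, e]
        abel
      neg_mem' := by
        rintro _ ⟨g, hg, v, hv, rfl⟩
        exact ⟨-g, G.neg_mem hg, -v, hVneg v hv, by simp only [neg_add]⟩ }
  refine ⟨L, hG.add hV, L.isOpen_of_mem_nhds (g := 0) (mem_of_superset hV0 fun v hv => ?_)⟩
  exact ⟨0, G.zero_mem, v, hv, by simp⟩

/-- A non-discrete locally compact field whose prime ring is relatively compact has a compact open
multiplicative neighbourhood `T` of `1` which some nonzero scalar moves into a compact open
multiplicatively closed set `N` disjoint from it. -/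
theorem exists_compact_open_mul_closed {K : Type*} [Field K] [TopologicalSpace K] [T2Space K]
    [IsTopologicalDivisionRing K] [LocallyCompactSpace K] (hK : ¬ DiscreteTopology K)
    (hZ : IsCompact ((AddSubgroup.zmultiples (1 : K)).topologicalClosure : Set K)) :
    ∃ (N T : Set K) (a : K), IsCompact N ∧ IsOpen N ∧ IsCompact T ∧ IsOpen T ∧
      (∀ x ∈ N, ∀ y ∈ N, x * y ∈ N) ∧ (∀ x ∈ T, ∀ y ∈ T, x * y ∈ T) ∧ (1 : K) ∈ T ∧
      Disjoint T N ∧ a ≠ 0 ∧ ∀ x ∈ T, a * x ∈ N := by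
  have hne : (𝓝[≠] (0 : K)).NeBot := by
    by_contra hcon
    rw [not_neBot] at hcon
    exact hK (discreteTopology_of_isOpen_singleton_zero
      (isOpen_singleton_iff_punctured_nhds 0 |>.2 hcon))
  obtain ⟨L, hLc, hLo⟩ := exists_compact_open_addSubgroup (A := K) fun x => by
    refine ⟨(AddSubgroup.zmultiples (1 : K)).topologicalClosure.map (AddMonoidHom.mulRight x),
      ?_, ?_⟩
    · rw [AddSubgroup.coe_map]
      exact hZ.image (continuous_mul_const x)
    · exact ⟨1, AddSubgroup.le_topologicalClosure _ (AddSubgroup.mem_zmultiples 1), by simp⟩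
  -- The multiplier ring of L is open because L is compact and open, and compact because Ol ⊆ L for
  -- a nonzero l in L.
  let O : Subring K :=
    { carrier := {x | ∀ l ∈ L, x * l ∈ L}
      zero_mem' := fun l _ => by simp [L.zero_mem]
      one_mem' := fun l hl => by simpa using hl
      add_mem' := fun {x y} hx hy l hl => by
        rw [add_mul]; exact L.add_mem (hx l hl) (hy l hl)
      neg_mem' := fun {x} hx l hl => by
        rw [neg_mul]; exact L.neg_mem (hx l hl)
      mul_mem' := fun {x y} hx hy l hl => by
        rw [mul_assoc]; exact hx _ (hy l hl) }
  have hO0 : (O : Set K) ∈ 𝓝 0 := by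
    have := hLc.eventually_forall_of_forall_eventually (x₀ := (0 : K))
      (P := fun x l => x * l ∈ L) fun l _ =>
        (continuous_mul.tendsto ((0 : K), l)).eventually (hLo.mem_nhds (by simp [L.zero_mem]))
    exact this
  have hOo : IsOpen (O : Set K) := O.toAddSubgroup.isOpen_of_mem_nhds hO0
  have hOc : IsCompact (O : Set K) := by
    obtain ⟨l, hl0, hl⟩ : ∃ l : K, l ≠ 0 ∧ l ∈ L := by
      have h1 : ∀ᶠ l in 𝓝[≠] (0 : K), l ∈ L := nhdsWithin_le_nhds (hLo.mem_nhds L.zero_mem)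
      obtain ⟨l, h1, h2⟩ := (h1.and self_mem_nhdsWithin).exists
      exact ⟨l, h2, h1⟩
    refine (hLc.image (continuous_mul_const l⁻¹)).of_isClosed_subset
      (O.toAddSubgroup.isClosed_of_isOpen hOo) fun x hx => ⟨x * l, hx l hl, ?_⟩
    simp [hl0]
  -- Otherwise nonzero x in O tending to 0 would have inverses in the compact set O, while xy ≠ 1
  -- for all y in O once x is near 0.
  obtain ⟨a, haO, ha0, ha⟩ : ∃ a ∈ O, a ≠ 0 ∧ a⁻¹ ∉ O := by
    by_contra! hcon
    have h0 : ∀ᶠ x in 𝓝 (0 : K), ∀ y ∈ (O : Set K), x * y ≠ 1 :=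
      hOc.eventually_forall_of_forall_eventually fun y _ =>
        (continuous_mul.tendsto ((0 : K), y)).eventually (isOpen_ne.mem_nhds (by simp))
    obtain ⟨x, ⟨hx, hxO⟩, hx0⟩ :=
      (((h0.and hO0).filter_mono nhdsWithin_le_nhds).and
        (self_mem_nhdsWithin (s := {(0 : K)}ᶜ))).exists
    exact hx _ (hcon x hxO hx0) (mul_inv_cancel₀ hx0)
  have hNo : IsOpen ((fun x => a * x) '' (O : Set K)) := (Homeomorph.mulLeft₀ a ha0).isOpenMap _ hOo
  have hNc : IsCompact ((fun x => a * x) '' (O : Set K)) := hOc.image (continuous_const_mul a)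
  refine ⟨(fun x => a * x) '' O, (fun x => 1 + x) '' ((fun x => a * x) '' O), a, hNc, hNo,
    hNc.image (continuous_const_add 1), isOpenMap_add_left 1 _ hNo, ?_, ?_, ?_, ?_, ha0, ?_⟩
  · rintro _ ⟨x, hx, rfl⟩ _ ⟨y, hy, rfl⟩
    exact ⟨x * (a * y), O.mul_mem hx (O.mul_mem haO hy), by ring⟩
  · rintro _ ⟨_, ⟨x, hx, rfl⟩, rfl⟩ _ ⟨_, ⟨y, hy, rfl⟩, rfl⟩
    refine ⟨_, ⟨x + y + x * (a * y), ?_, rfl⟩, by ring⟩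
    exact O.add_mem (O.add_mem hx hy) (O.mul_mem hx (O.mul_mem haO hy))
  · exact ⟨0, ⟨0, O.zero_mem, by simp⟩, by simp⟩
  · rw [Set.disjoint_left]
    rintro _ ⟨_, ⟨x, hx, rfl⟩, rfl⟩ ⟨y, hy, e⟩
    refine ha ?_
    have : a⁻¹ = y - x := inv_eq_of_mul_eq_one_right (by
      simp only at e; linear_combination e)
    rw [this]
    exact O.sub_mem hy hx
  · rintro _ ⟨_, ⟨x, hx, rfl⟩, rfl⟩
    exact ⟨1 + a * x, O.add_mem O.one_mem (O.mul_mem haO hx), rfl⟩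

/-! ### Idempotents in finite semigroups -/

/-- A nonempty multiplicatively closed subset of a finite semigroup contains an idempotent. -/
theorem exists_idempotent_of_finite_semigroup {F : Type*} [Semigroup F] [Finite F] (s : Set F)
    (hs : s.Nonempty) (hmul : ∀ x ∈ s, ∀ y ∈ s, x * y ∈ s) : ∃ e ∈ s, e * e = e := by
  let : TopologicalSpace F := ⊥
  have : DiscreteTopology F := ⟨rfl⟩
  exact exists_idempotent_in_compact_subsemigroup (fun _ => continuous_of_discreteTopology) s hs
    s.toFinite.isCompact hmul

/-- Let `T`, `N` be disjoint multiplicatively closed subsets of a finite semigroup. There is an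
idempotent `f ∈ T` such that no element of `N` in the corner at `f` has a left multiple in `T` by an
element of that corner. -/
theorem exists_idempotent_corner_mul_notMem {F : Type*} [Semigroup F] [Finite F] {T N : Set F}
    (hT : T.Nonempty) (hTT : ∀ x ∈ T, ∀ y ∈ T, x * y ∈ T) (hNN : ∀ x ∈ N, ∀ y ∈ N, x * y ∈ N)
    (hTN : Disjoint T N) :
    ∃ f ∈ T, f * f = f ∧ ∀ α β : F, f * α = α → f * β = β → β * f = β → β ∈ N → α * β ∉ T := by
  -- Minimality of the corner fFf makes f minimal among the idempotents of T.
  obtain ⟨f, ⟨hfT, hff⟩, hmin⟩ := Set.Finite.exists_minimalFor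
    (fun f : F => {x : F | f * x = x ∧ x * f = x}.ncard) {f | f ∈ T ∧ f * f = f} (toFinite _)
    (exists_idempotent_of_finite_semigroup T hT hTT)
  have hprim : ∀ e ∈ T, e * e = e → f * e = e → e * f = e → e = f := by
    intro e heT hee hfe hef
    have hsub : {x : F | e * x = x ∧ x * e = x} ⊆ {x : F | f * x = x ∧ x * f = x} := by
      rintro x ⟨h1, h2⟩
      exact ⟨by rw [← h1, ← mul_assoc, hfe], by rw [← h2, mul_assoc, hef]⟩
    have hle := hmin ⟨heT, hee⟩ (ncard_le_ncard hsub (toFinite _))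
    have heq := eq_of_subset_of_ncard_le hsub hle (toFinite _)
    have hf : f ∈ {x : F | e * x = x ∧ x * e = x} := heq ▸ ⟨hff, hff⟩
    exact hfe.symm.trans (hfe.trans (hef.symm.trans hf.1))
  refine ⟨f, hfT, hff, fun α β hα hβ hβ' hβN hαβ => ?_⟩
  -- An idempotent of T in the corner of the form yβ must be f, so β is left invertible relative to
  -- f.
  obtain ⟨e, ⟨heT, hfe, hef, y, rfl⟩, hee⟩ := exists_idempotent_of_finite_semigroup
    {x : F | x ∈ T ∧ f * x = x ∧ x * f = x ∧ ∃ y, x = y * β}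
    ⟨α * β, hαβ, by rw [← mul_assoc, hα], by rw [mul_assoc, hβ'], α, rfl⟩ (by
      rintro x ⟨hx, h1, h2, -⟩ x' ⟨hx', h1', h2', y, rfl⟩
      exact ⟨hTT _ hx _ hx', by rw [← mul_assoc, h1], by rw [mul_assoc, h2'], x * y,
        by rw [mul_assoc]⟩)
  have hyβ : y * β = f := hprim _ heT hee hfe hef
  -- Left invertibility passes to products, so N contains a left invertible idempotent g of the
  -- corner. Then g = fg = zgg = zg = f.
  obtain ⟨g, ⟨hgN, hfg, hgf, z, hz⟩, hgg⟩ := exists_idempotent_of_finite_semigroup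
    {x : F | x ∈ N ∧ f * x = x ∧ x * f = x ∧ ∃ y, y * x = f} ⟨β, hβN, hβ, hβ', y, hyβ⟩ (by
      rintro x ⟨hx, h1, h2, y, hy⟩ x' ⟨hx', h1', h2', y', hy'⟩
      refine ⟨hNN _ hx _ hx', by rw [← mul_assoc, h1], by rw [mul_assoc, h2'], y' * y, ?_⟩
      rw [mul_assoc, ← mul_assoc y, hy, h1', hy'])
  have hgf' : g = f := by rw [← hfg, ← hz, mul_assoc, hgg]
  exact Set.disjoint_left.1 hTN hfT (hgf' ▸ hgN)

/-! ### Relatively compact integers: the semigroup argument -/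

/-- Finitely many compact open sets are stable under all `W`-small displacements, for some
entourage `W`. -/
theorem exists_entourage_ball_subset {X ι : Type*} [UniformSpace X] [Finite ι] {S : ι → Set X}
    (hc : ∀ i, IsCompact (S i)) (ho : ∀ i, IsOpen (S i)) :
    ∃ W ∈ 𝓤 X, ∀ i, ∀ x ∈ S i, ∀ y, (x, y) ∈ W → y ∈ S i := by
  choose W hW _ hWS using fun i => lebesgue_number_of_compact_open (hc i) (ho i) subset_rfl
  refine ⟨⋂ i, W i, Filter.iInter_mem.2 hW, fun i x hx y hxy => hWS i x hx ?_⟩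
  exact mem_iInter.1 hxy i

/-- Intersecting with one entourage that has relatively compact sections removes that restriction on
W. -/
theorem ApproximableByFiniteRings.exists_approximation {K : Type*} [UniformSpace K] [Add K] [Mul K]
    (hU : IsUniformlyLocallyCompact K) (h : ApproximableByFiniteRings K) {C : Set K}
    (hC : IsCompact C) {W : Set (K × K)} (hW : W ∈ 𝓤 K) :
    ∃ (F : Type) (_ : NonUnitalRing F) (_ : Finite F) (j : F → K), IsCWApproximation C W j := by
  obtain ⟨W₀, hW₀, hc⟩ := hU
  obtain ⟨F, iF, hF, j, ⟨h1, h2⟩, h3⟩ := h C hC (W ∩ W₀) (inter_mem hW hW₀) fun x =>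
    (hc x).of_isClosed_subset isClosed_closure (closure_mono fun y hy => hy.2)
  refine ⟨F, iF, hF, j, ⟨fun a b ha hb hab => (h1 a b ha hb hab).1,
    fun a b ha hb hab => (h2 a b ha hb hab).1⟩, fun c hc => ?_⟩
  obtain ⟨m, hm, hm'⟩ := h3 c hc
  exact ⟨m, hm, hm'.1⟩

theorem not_approximable_of_isCompact_closure_zmultiples {K : Type*} [Field K] [UniformSpace K]
    [T2Space K] [IsTopologicalDivisionRing K] [LocallyCompactSpace K]
    (hU : IsUniformlyLocallyCompact K) (hK : ¬ DiscreteTopology K)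
    (hZ : IsCompact ((AddSubgroup.zmultiples (1 : K)).topologicalClosure : Set K)) :
    ¬ ApproximableByFiniteRings K := by
  intro happ
  obtain ⟨N, T, a, hNc, hNo, hTc, hTo, hNN, hTT, h1T, hTN, ha0, haT⟩ :=
    exists_compact_open_mul_closed hK hZ
  -- The four sets are N, a⁻¹T, T and aT. For a fine enough W, membership of a product in any of
  -- them passes from K to F.
  let S : Option (Fin 3) → Set K :=
    fun i => i.elim N fun i => (fun x => ![a⁻¹, 1, a] i * x) '' T
  have hu : ∀ i, (![a⁻¹, 1, a] : Fin 3 → K) i ≠ 0 := by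
    intro i; fin_cases i <;> simp [ha0]
  have hSc : ∀ i, IsCompact (S i)
    | none => hNc
    | some i => hTc.image (continuous_const_mul _)
  have hSo : ∀ i, IsOpen (S i)
    | none => hNo
    | some i => (Homeomorph.mulLeft₀ _ (hu i)).isOpenMap _ hTo
  obtain ⟨W, hW, hWS⟩ := exists_entourage_ball_subset hSc hSo
  obtain ⟨F, _, _, j, ⟨-, hmul⟩, hgrid⟩ :=
    happ.exists_approximation hU (isCompact_iUnion hSc) hW
  have key : ∀ i₁ i₂ i₃ x y, j x ∈ S i₁ → j y ∈ S i₂ → j x * j y ∈ S i₃ → j (x * y) ∈ S i₃ := by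
    intro i₁ i₂ i₃ x y hx hy hxy
    exact hWS _ _ hxy _ (hmul x y (mem_iUnion_of_mem _ hx) (mem_iUnion_of_mem _ hy)
      (mem_iUnion_of_mem _ hxy))
  have hgrid' : ∀ i c, c ∈ S i → ∃ x, j x ∈ S i := by
    intro i c hc
    obtain ⟨_, ⟨x, rfl⟩, hx⟩ := hgrid c (mem_iUnion_of_mem i hc)
    exact ⟨x, hWS _ _ hc _ hx⟩
  have hS1 : S (some 1) = T := by simp [S]
  have hSinv : S (some 0) = (fun x => a⁻¹ * x) '' T := by simp [S]
  have hSa : S (some 2) = (fun x => a * x) '' T := by simp [S]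
  have hleft : ∀ i f x, j f ∈ T → j x ∈ S (some i) → j (f * x) ∈ S (some i) := by
    intro i f x hf hx
    refine key (some 1) (some i) (some i) f x (hS1 ▸ hf) hx ?_
    obtain ⟨t, ht, e⟩ := hx
    exact ⟨j f * t, hTT _ hf _ ht, by rw [← e]; ring⟩
  have hright : ∀ i f x, j f ∈ T → j x ∈ S (some i) → j (x * f) ∈ S (some i) := by
    intro i f x hf hx
    refine key (some i) (some 1) (some i) x f hx (hS1 ▸ hf) ?_
    obtain ⟨t, ht, e⟩ := hx
    exact ⟨t * j f, hTT _ ht _ hf, by rw [← e]; ring⟩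
  obtain ⟨e₀, he₀⟩ := hgrid' (some 1) 1 (hS1 ▸ h1T)
  obtain ⟨α₀, hα₀⟩ := hgrid' (some 0) a⁻¹ (hSinv ▸ ⟨1, h1T, mul_one _⟩)
  obtain ⟨β₀, hβ₀⟩ := hgrid' (some 2) a (hSa ▸ ⟨1, h1T, mul_one _⟩)
  obtain ⟨f, hfT, hff, hf⟩ := exists_idempotent_corner_mul_notMem (T := j ⁻¹' T) (N := j ⁻¹' N)
    ⟨e₀, hS1 ▸ he₀⟩
    (fun x hx y hy => by
      have := hleft 1 x y hx (hS1.symm ▸ hy)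
      rwa [hS1] at this)
    (fun x hx y hy => key none none none x y hx hy (hNN _ hx _ hy))
    (hTN.preimage j)
  -- Multiplying by f on both sides moves the approximants of a⁻¹ and a into the corner without
  -- leaving a⁻¹T and aT.
  have hα := hright 0 f _ hfT (hleft 0 f α₀ hfT hα₀)
  have hβ := hright 2 f _ hfT (hleft 2 f β₀ hfT hβ₀)
  refine hf (f * α₀ * f) (f * β₀ * f) (by simp only [← mul_assoc, hff])
    (by simp only [← mul_assoc, hff]) (by rw [mul_assoc, hff]) ?_ ?_
  · rw [hSa] at hβ
    obtain ⟨t, ht, e⟩ := hβ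
    change j _ ∈ N
    rw [← e]
    exact haT t ht
  · have := key (some 0) (some 2) (some 1) _ _ hα hβ ?_
    · rwa [hS1] at this
    · rw [hSinv] at hα
      rw [hSa] at hβ
      obtain ⟨s, hs, e⟩ := hα
      obtain ⟨t, ht, e'⟩ := hβ
      rw [hS1, ← e, ← e']
      have : a⁻¹ * s * (a * t) = s * t := by field_simp
      simpa only [this] using hTT s hs t ht

/-! ### Integers not relatively compact: maximal escape times -/

/-- Let `D` be a subset of a finite additive monoid. Among the elements having some positive
multiple outside `D`, one stays in `D` the longest. -/
theorem exists_max_escape_time {F : Type*} [AddMonoid F] [Finite F] (D : Set F)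
    (hD : ∃ y : F, ∃ n : ℕ, 0 < n ∧ n • y ∉ D) :
    ∃ (x : F) (N : ℕ), 0 < N ∧ N • x ∉ D ∧ (∀ k, 0 < k → k < N → k • x ∈ D) ∧
      ∀ z : F, (∀ k, 0 < k → k ≤ N → k • z ∈ D) → ∀ k, 0 < k → k • z ∈ D := by
  classical
  let S : Set F := {y | ∃ n : ℕ, 0 < n ∧ n • y ∉ D}
  let τ : F → ℕ := fun y => if h : ∃ n : ℕ, 0 < n ∧ n • y ∉ D then Nat.find h else 0
  obtain ⟨x, hx, hmax⟩ := exists_max_image S τ S.toFinite hD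
  have hτ : ∀ y (h : y ∈ S), τ y = Nat.find h := fun y h => dif_pos h
  refine ⟨x, τ x, ?_, ?_, fun k hk hkx => ?_, fun z hz => ?_⟩
  · rw [hτ x hx]; exact (Nat.find_spec hx).1
  · rw [hτ x hx]; exact (Nat.find_spec hx).2
  · rw [hτ x hx] at hkx
    have := Nat.find_min hx hkx
    tauto
  · by_contra! hcon
    have hzS : z ∈ S := hcon
    have hle := hmax z hzS
    rw [hτ z hzS] at hle
    exact (Nat.find_spec hzS).2 (hz _ (Nat.find_spec hzS).1 hle)

/-- A family of approximate homomorphisms along which all precisions are eventually reached, and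
every point is a limit of images. -/
theorem ApproximableByFiniteRings.exists_ultrafilter {K : Type u} [UniformSpace K] [Add K] [Mul K]
    (hU : IsUniformlyLocallyCompact K) (h : ApproximableByFiniteRings K) :
    ∃ (I : Type u) (U : Ultrafilter I) (F : I → Type) (_ : ∀ i, NonUnitalRing (F i))
      (_ : ∀ i, Finite (F i)) (j : ∀ i, F i → K),
      (∀ C : Set K, IsCompact C → ∀ W ∈ 𝓤 K, ∀ᶠ i in U, IsApproxHom C W (j i)) ∧
      ∀ v : K, ∃ y : ∀ i, F i, Tendsto (fun i => j i (y i)) U (𝓝 v) := by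
  -- Indices increase with larger compact sets and, through the order dual, smaller entourages. An
  -- ultrafilter above all of them gives a limit to every family that eventually stays in a compact
  -- set.
  have key := fun i : TopologicalSpace.Compacts K × {W : Set (K × K) // W ∈ 𝓤 K}ᵒᵈ =>
    h.exists_approximation hU i.1.isCompact (OrderDual.ofDual i.2).2
  choose F iF hF j hj using key
  have hdir : (atTop : Filter (TopologicalSpace.Compacts K ×
      {W : Set (K × K) // W ∈ 𝓤 K}ᵒᵈ)).NeBot :=
    atTop_neBot_iff.2 ⟨⟨⊥, OrderDual.toDual ⟨univ, univ_mem⟩⟩, ⟨fun a b =>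
      ⟨(a.1 ⊔ b.1, OrderDual.toDual ⟨(OrderDual.ofDual a.2).1 ∩ (OrderDual.ofDual b.2).1,
        inter_mem (OrderDual.ofDual a.2).2 (OrderDual.ofDual b.2).2⟩),
        ⟨le_sup_left, fun _ hx => hx.1⟩, ⟨le_sup_right, fun _ hx => hx.2⟩⟩⟩⟩
  obtain ⟨U, hUtop⟩ := Ultrafilter.exists_le (atTop : Filter (TopologicalSpace.Compacts K ×
    {W : Set (K × K) // W ∈ 𝓤 K}ᵒᵈ))
  have hev : ∀ C : Set K, IsCompact C → ∀ W ∈ 𝓤 K,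
      ∀ᶠ i : TopologicalSpace.Compacts K × {W : Set (K × K) // W ∈ 𝓤 K}ᵒᵈ in U,
        C ⊆ i.1 ∧ (OrderDual.ofDual i.2).1 ⊆ W :=
    fun C hC W hW => hUtop
      (eventually_ge_atTop (⟨⟨C, hC⟩, OrderDual.toDual ⟨W, hW⟩⟩ :
        TopologicalSpace.Compacts K × {W : Set (K × K) // W ∈ 𝓤 K}ᵒᵈ))
  refine ⟨_, U, F, iF, hF, j, fun C hC W hW => ?_, fun v => ?_⟩
  · filter_upwards [hev C hC W hW] with i ⟨hC', hW'⟩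
    obtain ⟨⟨h1, h2⟩, -⟩ := hj i
    exact ⟨fun a b ha hb hab => hW' (h1 a b (hC' ha) (hC' hb) (hC' hab)),
      fun a b ha hb hab => hW' (h2 a b (hC' ha) (hC' hb) (hC' hab))⟩
  · have hex : ∀ i, ∃ y : F i, v ∈ i.1 → (v, j i y) ∈ (OrderDual.ofDual i.2).1 := by
      intro i
      by_cases hv : v ∈ i.1
      · obtain ⟨_, ⟨y, rfl⟩, hy⟩ := (hj i).2 v hv
        exact ⟨y, fun _ => hy⟩
      · exact ⟨0, fun h' => absurd h' hv⟩
    choose y hy using hex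
    refine ⟨y, Uniform.tendsto_nhds_right.2 fun W hW => mem_map.2 ?_⟩
    filter_upwards [hev {v} isCompact_singleton W hW] with i hi
    exact hi.2 (hy i (hi.1 rfl))

/-- Approximate homomorphisms of increasing precision respect limits of operations. -/
theorem tendsto_op_of_approxHom {K I : Type*} [UniformSpace K] [LocallyCompactSpace K]
    {l : Filter I} {F : I → Type*} {j : ∀ i, F i → K} {opK : K → K → K}
    {opF : ∀ i, F i → F i → F i} (hop : Continuous fun p : K × K => opK p.1 p.2)
    (h : ∀ C : Set K, IsCompact C → ∀ W ∈ 𝓤 K, ∀ᶠ i in l, IsApproxHomFor C W opK (opF i) (j i))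
    {x y : ∀ i, F i} {u v : K} (hx : Tendsto (fun i => j i (x i)) l (𝓝 u))
    (hy : Tendsto (fun i => j i (y i)) l (𝓝 v)) :
    Tendsto (fun i => j i (opF i (x i) (y i))) l (𝓝 (opK u v)) := by
  have hxy : Tendsto (fun i => opK (j i (x i)) (j i (y i))) l (𝓝 (opK u v)) :=
    (hop.tendsto (u, v)).comp (hx.prodMk_nhds hy)
  obtain ⟨A, hA, hAu⟩ := exists_compact_mem_nhds u
  obtain ⟨B, hB, hBv⟩ := exists_compact_mem_nhds v
  obtain ⟨C, hC, hCuv⟩ := exists_compact_mem_nhds (opK u v)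
  refine hxy.congr_uniformity fun W hW => mem_map.2 ?_
  filter_upwards [h (A ∪ B ∪ C) ((hA.union hB).union hC) W hW, hx hAu, hy hBv, hxy.eventually hCuv]
    with i hi h1 h2 h3
  exact hi _ _ (.inl (.inl h1)) (.inl (.inr h2)) (.inr h3)

/-- If the integers are not relatively compact in a field, no compact set contains all positive
multiples of a nonzero element. -/
theorem exists_nsmul_notMem_of_not_isCompact {K : Type*} [Field K] [TopologicalSpace K] [T2Space K]
    [IsTopologicalRing K]
    (hZ : ¬ IsCompact ((AddSubgroup.zmultiples (1 : K)).topologicalClosure : Set K)) {D : Set K}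
    (hD : IsCompact D) {v : K} (hv : v ≠ 0) : ∃ n : ℕ, 0 < n ∧ n • v ∉ D := by
  by_contra! hcon
  have hE : IsCompact ((fun x => x * v⁻¹) '' (insert 0 (D ∪ -D))) :=
    ((hD.union hD.neg).insert 0).image (continuous_mul_const _)
  refine hZ (hE.of_isClosed_subset (AddSubgroup.isClosed_topologicalClosure _)
    (closure_minimal ?_ hE.isClosed))
  rintro _ ⟨n, rfl⟩
  refine ⟨n • v, ?_, by simp [hv]⟩
  rcases lt_trichotomy n 0 with hn | rfl | hn
  · refine .inr (.inr ?_)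
    obtain ⟨m, rfl⟩ := (Int.eq_ofNat_of_zero_le (a := -n) (by omega)).imp fun m hm =>
      neg_eq_iff_eq_neg.1 hm
    simpa using hcon m (by omega)
  · simp
  · obtain ⟨m, rfl⟩ := Int.eq_ofNat_of_zero_le hn.le
    refine .inr (.inl ?_)
    simpa using hcon m (by omega)

theorem not_approximable_of_not_isCompact_closure_zmultiples {K : Type*} [Field K] [UniformSpace K]
    [T2Space K] [IsTopologicalDivisionRing K] [LocallyCompactSpace K]
    (hU : IsUniformlyLocallyCompact K) (hK : ¬ DiscreteTopology K)
    (hZ : ¬ IsCompact ((AddSubgroup.zmultiples (1 : K)).topologicalClosure : Set K)) :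
    ¬ ApproximableByFiniteRings K := by
  intro happ
  obtain ⟨I, U, F, _, _, j, hj, hgrid⟩ := happ.exists_ultrafilter hU
  have hadd : ∀ {x y : ∀ i, F i} {u v : K}, Tendsto (fun i => j i (x i)) U (𝓝 u) →
      Tendsto (fun i => j i (y i)) U (𝓝 v) →
      Tendsto (fun i => j i (x i + y i)) U (𝓝 (u + v)) :=
    tendsto_op_of_approxHom (opF := fun i => (· + ·)) continuous_add
      fun C hC W hW => (hj C hC W hW).mono fun i hi => hi.1
  have hmul : ∀ {x y : ∀ i, F i} {u v : K}, Tendsto (fun i => j i (x i)) U (𝓝 u) →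
      Tendsto (fun i => j i (y i)) U (𝓝 v) →
      Tendsto (fun i => j i (x i * y i)) U (𝓝 (u * v)) :=
    tendsto_op_of_approxHom (opF := fun i => (· * ·)) continuous_mul
      fun C hC W hW => (hj C hC W hW).mono fun i hi => hi.2
  have hnsmul : ∀ {x : ∀ i, F i} {u : K}, Tendsto (fun i => j i (x i)) U (𝓝 u) →
      ∀ n : ℕ, 0 < n → Tendsto (fun i => j i (n • x i)) U (𝓝 (n • u)) := by
    intro x u hx n hn
    induction n, hn using Nat.le_induction with
    | base => simpa using hx
    | succ n hn ih => simpa only [succ_nsmul] using hadd ih hx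
  obtain ⟨D, hD, hD0⟩ := exists_compact_mem_nhds (0 : K)
  have hlim : ∀ {x : ∀ i, F i}, (∀ᶠ i in U, j i (x i) ∈ D) →
      ∃ u ∈ D, Tendsto (fun i => j i (x i)) U (𝓝 u) := fun {x} hx =>
    hD.ultrafilter_le_nhds (U.map fun i => j i (x i)) (le_principal_iff.2 hx)
  have hescape : ∀ {v : K}, v ≠ 0 → ∃ n : ℕ, 0 < n ∧ n • v ∉ D :=
    fun hv => exists_nsmul_notMem_of_not_isCompact hZ hD hv
  have hzero : ∀ {x : ∀ i, F i} {u : K}, Tendsto (fun i => j i (x i)) U (𝓝 u) →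
      (∀ k : ℕ, 0 < k → ∀ᶠ i in U, j i (k • x i) ∈ D) → u = 0 := by
    intro x u hx h
    by_contra hu
    obtain ⟨n, hn, hnu⟩ := hescape hu
    exact hnu (hD.isClosed.mem_of_tendsto (hnsmul hx n hn) (h n hn))
  have hmax : ∀ i, ∃ (x : F i) (N : ℕ), (∃ y : F i, ∃ n : ℕ, 0 < n ∧ j i (n • y) ∉ D) →
      0 < N ∧ j i (N • x) ∉ D ∧ (∀ k, 0 < k → k < N → j i (k • x) ∈ D) ∧
      ∀ z : F i, (∀ k, 0 < k → k ≤ N → j i (k • z) ∈ D) → ∀ k, 0 < k → j i (k • z) ∈ D := by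
    intro i
    by_cases h : ∃ y : F i, ∃ n : ℕ, 0 < n ∧ j i (n • y) ∉ D
    · obtain ⟨x, N, hxN⟩ := exists_max_escape_time (j i ⁻¹' D) h
      exact ⟨x, N, fun _ => hxN⟩
    · exact ⟨0, 0, fun h' => absurd h' h⟩
  choose x N hxN using hmax
  -- Elements of F approximating a small nonzero v escape, but not within m steps, so the maximal
  -- escape time exceeds m.
  have hlong : ∀ m : ℕ, ∀ᶠ i in U, m < N i ∧ ∃ y : F i, ∃ n : ℕ, 0 < n ∧ j i (n • y) ∉ D := by
    intro m
    have hne : (𝓝[≠] (0 : K)).NeBot := by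
      by_contra hcon
      rw [not_neBot] at hcon
      exact hK (discreteTopology_of_isOpen_singleton_zero
        (isOpen_singleton_iff_punctured_nhds 0 |>.2 hcon))
    have hsmall : ∀ᶠ v in 𝓝 (0 : K), ∀ k ∈ Finset.range (m + 1), k • v ∈ interior D :=
      (Filter.eventually_all_finset _).2 fun k _ =>
        ((continuous_const_smul k).tendsto (0 : K)).eventually
          (isOpen_interior.mem_nhds (by simpa using mem_interior_iff_mem_nhds.2 hD0))
    obtain ⟨v, hv, hv0⟩ :=
      ((hsmall.filter_mono nhdsWithin_le_nhds).and (self_mem_nhdsWithin (s := {(0 : K)}ᶜ))).exists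
    obtain ⟨n, hn, hnv⟩ := hescape hv0
    obtain ⟨y, hy⟩ := hgrid v
    have h1 : ∀ᶠ i in U, ∀ k ∈ Finset.range (m + 1), 0 < k → j i (k • y i) ∈ D := by
      refine (Filter.eventually_all_finset _).2 fun k hk => ?_
      rcases Nat.eq_zero_or_pos k with rfl | hk0
      · simp
      · filter_upwards [(hnsmul hy k hk0).eventually (isOpen_interior.mem_nhds (hv k hk))]
          with i hi _ using interior_subset hi
    filter_upwards [h1, (hnsmul hy n hn).eventually (hD.isClosed.isOpen_compl.mem_nhds hnv)]
      with i hi hi'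
    have hex : ∃ y : F i, ∃ n : ℕ, 0 < n ∧ j i (n • y) ∉ D := ⟨y i, n, hn, hi'⟩
    refine ⟨?_, hex⟩
    by_contra! hle
    exact hi' ((hxN i hex).2.2.2 (y i)
      (fun k hk hkN => hi k (Finset.mem_range.2 (by omega)) hk) n hn)
  have hx0 : Tendsto (fun i => j i (x i)) U (𝓝 0) := by
    have hk : ∀ k : ℕ, 0 < k → ∀ᶠ i in U, j i (k • x i) ∈ D := fun k hk =>
      (hlong k).mono fun i hi => (hxN i hi.2).2.2.1 k hk hi.1
    obtain ⟨u, -, hu⟩ := hlim (x := x) (by simpa using hk 1 one_pos)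
    exact hzero hu hk ▸ hu
  -- The multiple (N - 1)x is still in D and so has a limit. Since x tends to 0, Nx has the same
  -- limit, and Nx ∉ D keeps it away from 0.
  obtain ⟨w, hw0, hw⟩ : ∃ w : K, w ≠ 0 ∧ Tendsto (fun i => j i (N i • x i)) U (𝓝 w) := by
    obtain ⟨w, -, hw⟩ := hlim (x := fun i => (N i - 1) • x i)
      ((hlong 1).mono fun i hi => (hxN i hi.2).2.2.1 _ (by omega) (by omega))
    have hw' : Tendsto (fun i => j i (N i • x i)) U (𝓝 w) := by
      refine (add_zero w ▸ hadd hw hx0).congr' ((hlong 1).mono fun i hi => ?_)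
      simp only
      rw [← succ_nsmul, Nat.sub_add_cancel hi.1.le]
    refine ⟨w, ?_, hw'⟩
    rintro rfl
    obtain ⟨i, hi, hi'⟩ := ((hw'.eventually hD0).and (hlong 1)).exists
    exact (hxN i hi'.2).2.1 hi
  have hsq : ∀ᶠ i in U, ∀ k, 0 < k → j i (k • (x i * x i)) ∈ D := by
    suffices h : ∀ᶠ i in U, ∀ k, 0 < k → k ≤ N i → j i (k • (x i * x i)) ∈ D by
      filter_upwards [h, hlong 1] with i hi hi' using (hxN i hi'.2).2.2.2 _ hi
    by_contra hcon
    rw [← Ultrafilter.eventually_not] at hcon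
    have hch : ∀ i, ∃ k : ℕ, (¬ ∀ k, 0 < k → k ≤ N i → j i (k • (x i * x i)) ∈ D) →
        0 < k ∧ k ≤ N i ∧ j i (k • (x i * x i)) ∉ D := by
      intro i
      by_cases h : ∀ k, 0 < k → k ≤ N i → j i (k • (x i * x i)) ∈ D
      · exact ⟨0, fun h' => absurd h h'⟩
      · push Not at h
        obtain ⟨k, hk⟩ := h
        exact ⟨k, fun _ => hk⟩
    choose k hk using hch
    -- The case k = N is separate because Nx lies outside D; its limit is w.
    obtain ⟨c, hc⟩ : ∃ c, Tendsto (fun i => j i (k i • x i)) U (𝓝 c) := by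
      rcases U.em (fun i => k i = N i) with h | h
      · exact ⟨w, hw.congr' (h.mono fun i hi => by simp only [hi])⟩
      · obtain ⟨c, -, hc⟩ := hlim (x := fun i => k i • x i) (by
          filter_upwards [h, hcon, hlong 1] with i h1 h2 h3
          exact (hxN i h3.2).2.2.1 _ (hk i h2).1 (lt_of_le_of_ne (hk i h2).2.1 h1))
        exact ⟨c, hc⟩
    obtain ⟨i, hi, hi'⟩ :=
      (((mul_zero c ▸ hmul hc hx0).eventually hD0).and hcon).exists
    refine (hk i hi').2.2 ?_
    rw [← smul_mul_assoc]
    exact hi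
  -- Since k(Nx)² = (kN²)x², every positive multiple of (Nx)² is a positive multiple of x² and stays
  -- in D.
  refine mul_ne_zero hw0 hw0 (hzero (hmul hw hw) fun k hk => ?_)
  filter_upwards [hsq, hlong 1] with i hi hi'
  have := hi (k * (N i * N i)) (by have := hi'.1; positivity)
  rwa [smul_mul_smul_comm, smul_smul]

theorem theorem1 {K : Type*} [Field K] [UniformSpace K] [T2Space K]
    [IsTopologicalDivisionRing K] [LocallyCompactSpace K]
    (hU : IsUniformlyLocallyCompact K) (hK : ¬ DiscreteTopology K) :
    ¬ ApproximableByFiniteRings K := by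
  by_cases hZ : IsCompact ((AddSubgroup.zmultiples (1 : K)).topologicalClosure : Set K)
  · exact not_approximable_of_isCompact_closure_zmultiples hU hK hZ
  · exact not_approximable_of_not_isCompact_closure_zmultiples hU hK hZ
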